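/- Let $d\ge 1$ (physically $d=3$) and consider a homogeneous viscoelastic medium in $\mathbb{R}^d$ with constant mass density $\rho>0$ and relaxation modulus $t\mapsto \mathsf{G}(t)=(G_{klmn}(t))$, $t>0$: a real tensor-valued function, locally integrable on $[0,\infty[$, with $G_{klmn}=G_{lkmn}=G_{klnm}=G_{mnkl}$. The displacement $u$ and the stress $\sigma$ satisfy (summation convention) $$\rho\,\partial_t^2u_k=\partial_l\sigma_{kl}\quad (t>0),\qquad \sigma_{kl}=G_{klmn}\ast\partial_n\partial_tu_m,\qquad (f\ast g)(t)=\int_0^\infty f(s)\,g(t-s)\,\mathrm{d}s .$$ For time-harmonic motions the convolution is understood in the sense of Abel, as $\lim_{\varepsilon\to0+}\int_0^\infty \mathrm{e}^{-\varepsilon s}f(s)\,g(t-s)\,\mathrm{d}s$; equivalently, the Laplace transform $\tilde{\mathsf{G}}(-\mathrm{i}\omega)$ is the boundary value $\lim_{\varepsilon\to 0+}\tilde{\mathsf{G}}(\varepsilon-\mathrm{i}\omega)$. The energy flux density is $\Psi_l=-\sigma_{kl}\,\partial_tu_k$. For $\omega>0$ and $\mathbf{a},\mathbf{k}\in\mathbb{C}^d$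 let $u(t,x)=\mathrm{Re}\left[\mathbf{a}\,\mathrm{e}^{-\mathrm{i}\omega t+\mathrm{i}\mathbf{k}\cdot x}\right]$ be a plane wave, where $\mathbf{k}\cdot x=\sum_j k_jx_j$ and the real and imaginary parts of $\mathbf{k}$ need not be collinear. Let $\mathbf{k}^{\mathrm{I}}=\mathrm{Im}\,\mathbf{k}$ be its attenuation vector and $\langle\Psi\rangle(x)=\frac1T\int_0^T\Psi(t,x)\,\mathrm{d}t$, $T=2\pi/\omega$, its time-averaged energy flux density. The relaxation modulus is called LICM if, in addition, for every real symmetric $d\times d$ matrix $e$ the function $f_e(t)=e_{kl}G_{klmn}(t)e_{mn}$ is completely monotone: it is infinitely differentiable on $]0,\infty[$ and $(-1)^nf_e^{(n)}(t)\ge0$ for all $t>0$ and $n=0,1,2,\dots$ **Statement.** If the relaxation modulus is LICM, then for all such $\omega,\mathbf{a},\mathbf{k}$ the stress and the time-averaged flux are well defined (the Abel limits exist and $\Psi$ is integrable over a period), and for every plane wave that solves the equation of motion $$\langle\Psi\rangle(x)\cdot\mathbf{k}^{\mathrm{I}}\ge0\qquad\text{for all }x\in\mathbb{R}^d,$$ that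 is, the angle between the time-averaged energy flux density and the attenuation vector is at most $\pi/2$ (acute, or right in limiting cases such as evanescent waves in an elastic medium, where $\mathsf{G}$ is constant; a zero vector is regarded as making a right angle with every vector). Only the first three of the inequalities are needed: the same conclusion holds if, instead of complete monotonicity, each $f_e$ is only assumed to be twice differentiable on $]0,\infty[$ with $f_e\ge0$, $f_e'\le0$, $f_e''\ge0$; and it holds, without any differentiability assumption, if each $f_e$ is only assumed to be non-negative, non-increasing and convex on $]0,\infty[$. -/

import Mathlib

open MeasureTheory Set Filter Topology

namespace Viscoelastic

noncomputable section

/-- A time dependent real tensor of rank four `t ↦ G_{klmn}(t)` on `ℝ^d`. Only the values at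
`t > 0` are relevant. -/
abbrev TensorFun (d : ℕ) : Type := ℝ → Fin d → Fin d → Fin d → Fin d → ℝ

/-- Points and real vectors of `ℝ^d`, with the Euclidean scalar product. -/
abbrev Vec (d : ℕ) : Type := EuclideanSpace ℝ (Fin d)

/-- `G` is locally integrable on `[0, ∞[`, and for `t > 0` it takes values in the symmetric
operators on the space of symmetric `d × d` matrices (minor and major symmetries). -/
structure IsRelaxationModulus {d : ℕ} (G : TensorFun d) : Prop where
  locallyIntegrable : ∀ k l m n, LocallyIntegrableOn (fun t => G t k l m n) (Ici 0)
  minor_left : ∀ t, 0 < t → ∀ k l m n, G t k l m n = G t l k m n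
  minor_right : ∀ t, 0 < t → ∀ k l m n, G t k l m n = G t k l n m
  major : ∀ t, 0 < t → ∀ k l m n, G t k l m n = G t m n k l

/-- The quadratic form `⟨e, G(t) e⟩ = ∑ e_{kl} G_{klmn}(t) e_{mn}` as a function of time. -/
def quadForm {d : ℕ} (G : TensorFun d) (e : Matrix (Fin d) (Fin d) ℝ) (t : ℝ) : ℝ :=
  ∑ k, ∑ l, ∑ m, ∑ n, e k l * G t k l m n * e m n

/-- A scalar function is completely monotone on `]0, ∞[`. -/
def CompletelyMonotone (f : ℝ → ℝ) : Prop :=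
  ContDiffOn ℝ (⊤ : ℕ∞) f (Ioi 0) ∧ ∀ n : ℕ, ∀ t, 0 < t → 0 ≤ (-1) ^ n * iteratedDeriv n f t

/-- A twice differentiable function on `]0, ∞[` satisfying the first three of the inequalities
that define complete monotonicity: `f ≥ 0`, `f' ≤ 0`, `f'' ≥ 0`. -/
def FirstThreeInequalities (f : ℝ → ℝ) : Prop :=
  DifferentiableOn ℝ f (Ioi 0) ∧ DifferentiableOn ℝ (deriv f) (Ioi 0) ∧
    ∀ n : ℕ, n ≤ 2 → ∀ t, 0 < t → 0 ≤ (-1) ^ n * iteratedDeriv n f t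

/-- The same three conditions without differentiability. -/
def NonnegAntitoneConvex (f : ℝ → ℝ) : Prop :=
  (∀ t, 0 < t → 0 ≤ f t) ∧ AntitoneOn f (Ioi 0) ∧ ConvexOn ℝ (Ioi 0) f

/-- A scalar condition, imposed on a tensor valued function in the sense of quadratic forms on the
symmetric matrices. -/
def InFormSense {d : ℕ} (P : (ℝ → ℝ) → Prop) (G : TensorFun d) : Prop :=
  ∀ e : Matrix (Fin d) (Fin d) ℝ, e.IsSymm → P (quadForm G e)

/-- `G` is a locally integrable completely monotone (LICM) relaxation modulus. -/
def IsLICM {d : ℕ} (G : TensorFun d) : Prop :=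
  IsRelaxationModulus G ∧ InFormSense CompletelyMonotone G

/-- The real plane wave `u(t, x) = Re [a exp(-iωt + i k·x)]` with complex amplitude `a` and complex
wave vector `k`. -/
def planeWave {d : ℕ} (ω : ℝ) (a k : Fin d → ℂ) (t : ℝ) (x : Vec d) : Fin d → ℝ :=
  fun m => (a m * Complex.exp (-Complex.I * ω * t + Complex.I * ∑ j, k j * (x j : ℂ))).re

/-- The attenuation vector: the imaginary part of the wave vector. -/
def attenuationVector {d : ℕ} (k : Fin d → ℂ) : Vec d :=
  WithLp.toLp 2 fun j => (k j).im

/-- Partial derivative in the `n`-th coordinate direction. -/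
def partialDeriv {d : ℕ} (n : Fin d) (f : Vec d → ℝ) (x : Vec d) : ℝ :=
  lineDeriv ℝ f x (EuclideanSpace.single n 1)

/-- Particle velocity `∂u_m/∂t`. -/
def velocity {d : ℕ} (u : ℝ → Vec d → Fin d → ℝ) (t : ℝ) (x : Vec d) (m : Fin d) : ℝ :=
  deriv (fun τ => u τ x m) t

/-- The Volterra convolution with a convergence factor:
`∫_0^∞ exp(-εs) G_{klmn}(s) ∂_n (∂u_m/∂t)(t - s, x) ds`, summed over `m, n`. -/
def dampedStress {d : ℕ} (G : TensorFun d) (u : ℝ → Vec d → Fin d → ℝ) (ε t : ℝ) (x : Vec d)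
    (k l : Fin d) : ℝ :=
  ∫ s in Ioi (0 : ℝ), Real.exp (-ε * s) *
    ∑ m, ∑ n, G s k l m n * partialDeriv n (fun y => velocity u (t - s) y m) x

/-- The stress `σ_{kl} = G_{klmn} ∗ ∂_n (∂u_m/∂t)`. The integral over the infinite past of a
time-harmonic motion need not converge when `G(t)` has a nonzero limit at infinity; it is taken in
the sense of Abel, i.e. the Laplace transform of `G` on the imaginary axis is its boundary value from
the right half-plane. -/
def stress {d : ℕ} (G : TensorFun d) (u : ℝ → Vec d → Fin d → ℝ) (t : ℝ) (x : Vec d)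
    (k l : Fin d) : ℝ :=
  limUnder (𝓝[>] (0 : ℝ)) fun ε => dampedStress G u ε t x k l

/-- The limit in the definition of the stress exists, everywhere. -/
def StressExists {d : ℕ} (G : TensorFun d) (u : ℝ → Vec d → Fin d → ℝ) : Prop :=
  ∀ t x k l, Tendsto (fun ε => dampedStress G u ε t x k l) (𝓝[>] 0) (𝓝 (stress G u t x k l))

/-- The equation of motion `ρ ∂²u_k/∂t² = ∑_l ∂σ_{kl}/∂x_l` for `t > 0`. -/
def SolvesMotion {d : ℕ} (ρ : ℝ) (G : TensorFun d) (u : ℝ → Vec d → Fin d → ℝ) : Prop :=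
  ∀ t, 0 < t → ∀ x k,
    ρ * deriv (fun τ => velocity u τ x k) t =
      ∑ l, partialDeriv l (fun y => stress G u t y k l) x

/-- The energy flux density `Ψ_l = -∑_k σ_{kl} ∂u_k/∂t`. -/
def energyFlux {d : ℕ} (G : TensorFun d) (u : ℝ → Vec d → Fin d → ℝ) (t : ℝ) (x : Vec d) : Vec d :=
  WithLp.toLp 2 fun l => -∑ k, stress G u t x k l * velocity u t x k

/-- The average `T⁻¹ ∫_0^T Ψ(t, x) dt` of the energy flux density over a time interval of
length `T`. -/
def averageFlux {d : ℕ} (G : TensorFun d) (u : ℝ → Vec d → Fin d → ℝ) (T : ℝ) (x : Vec d) : Vec d :=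
  (1 / T) • ∫ t in (0 : ℝ)..T, energyFlux G u t x

/-- In the medium with density `ρ` and relaxation modulus `G`: for all plane waves of frequency
`ω > 0` the stress and the time-averaged flux are well defined, and if the wave solves the equation
of motion, then the angle between the flux averaged over a period and the attenuation vector is not
obtuse. (It is a right angle, e.g., for evanescent waves in an elastic medium.) -/
def FluxAngleAcute {d : ℕ} (ρ : ℝ) (G : TensorFun d) : Prop :=
  ∀ (ω : ℝ) (a k : Fin d → ℂ), 0 < ω →
    StressExists G (planeWave ω a k) ∧
    (∀ x, IntervalIntegrable (fun t => energyFlux G (planeWave ω a k) t x) volume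
      0 (2 * Real.pi / ω)) ∧
    (SolvesMotion ρ G (planeWave ω a k) → ∀ x,
      0 ≤ inner ℝ (averageFlux G (planeWave ω a k) (2 * Real.pi / ω) x) (attenuationVector k) ∧
      InnerProductGeometry.angle (averageFlux G (planeWave ω a k) (2 * Real.pi / ω) x)
        (attenuationVector k) ≤ Real.pi / 2)

end

end Viscoelastic

/-! For a plane wave, convolution with `G` becomes multiplication by the boundary value `A` of its
Laplace transform at `-iω`, so the stress has complex amplitude `S = ω A w` with `w = a ⊗ k`.
Averaging over a period and writing the imaginary part of `k` as a difference of `k` and its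
conjugate splits `⟨Ψ⟩ · Im k`, up to a nonnegative factor, into `Re ∑ conj(a_i k_l) S_il` minus `Re
∑ conj(a_i) S_il k_l` (`neg_sum_attenuation_mul_eq`). The equation of motion gives `∑ S_il k_l = i ρ
ω² a_i`, so the second term vanishes. The first is `ω` times the real part of the sesquilinear form
of `A` at `w`, and everything reduces to the positivity of `Re A`.

By the symmetries of `A` it suffices to test real symmetric matrices `e`
(`tensorForm_conj_re_nonneg`). There the real part is the limit of `∫ cos(ωs) exp(-εs) f_e(s) ds`,
and the cosine integral of an integrable convex function over the half-line is nonnegative, period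
by period (`integral_Ioi_cos_mul_nonneg_of_convexOn`).

Existence of the Abel limit needs only that `f_e` be locally integrable, nonnegative and
nonincreasing: a shift by half a period replaces `f_e` by an integrable difference
(`exists_hasAbelTransform_of_antitoneOn`). Polarization then passes from the quadratic forms to the
entries of `G`. -/

namespace Viscoelastic

/-! ### Nonnegativity of cosine integrals of convex functions. -/

section CosineIntegral

/-- The cosine is odd about `h / 2`. Pairing `s` with `h - s` leaves `cos(πs/h) (p s - p (h - s))`,
whose two factors change sign together at `h / 2`. -/
theorem integral_cos_mul_nonneg_of_antitoneOn {p : ℝ → ℝ} {h : ℝ} (hh : 0 < h)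
    (hint : IntervalIntegrable p volume 0 h) (hp : AntitoneOn p (Ioo 0 h)) :
    0 ≤ ∫ s in (0 : ℝ)..h, Real.cos (Real.pi / h * s) * p s := by
  have hint' : IntervalIntegrable (fun s => Real.cos (Real.pi / h * s) * p s) volume 0 h :=
    hint.continuousOn_mul (by fun_prop)
  have hrefl := intervalIntegral.integral_comp_sub_left (a := 0) (b := h)
    (fun s => Real.cos (Real.pi / h * s) * p s) h
  have hint'' := (hint'.comp_sub_left h).symm
  simp only [sub_self, sub_zero] at hrefl hint''
  have hcos : ∀ s, Real.cos (Real.pi / h * (h - s)) = -Real.cos (Real.pi / h * s) := fun s => by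
    rw [← Real.cos_pi_sub]; congr 1; field_simp
  have hsum : 0 ≤ ∫ s in (0 : ℝ)..h, (Real.cos (Real.pi / h * s) * p s +
      Real.cos (Real.pi / h * (h - s)) * p (h - s)) := by
    rw [intervalIntegral.integral_of_le hh.le, integral_Ioc_eq_integral_Ioo]
    refine setIntegral_nonneg measurableSet_Ioo fun s hs => ?_
    rw [hcos, neg_mul, ← sub_eq_add_neg, ← mul_sub]
    have hs' : h - s ∈ Ioo 0 h := ⟨by linarith [hs.2], by linarith [hs.1]⟩
    have key : Real.pi / h * s = Real.pi * (s / h) := by ring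
    have hpi := Real.pi_pos
    rcases le_total s (h - s) with hle | hle
    · refine mul_nonneg (Real.cos_nonneg_of_neg_pi_div_two_le_of_le ?_ ?_)
        (sub_nonneg.2 (hp hs hs' hle))
      · have := mul_pos (div_pos hpi hh) hs.1
        linarith
      · have : s / h ≤ 1 / 2 := by rw [div_le_iff₀ hh]; linarith
        rw [key]; nlinarith
    · refine mul_nonneg_of_nonpos_of_nonpos
        (Real.cos_nonpos_of_pi_div_two_le_of_le ?_ ?_) (sub_nonpos.2 (hp hs' hs hle))
      · have : 1 / 2 ≤ s / h := by rw [le_div_iff₀ hh]; linarith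
        rw [key]; nlinarith
      · have : s / h ≤ 1 := by rw [div_le_iff₀ hh]; linarith [hs.2]
        rw [key]; nlinarith
  rw [intervalIntegral.integral_add hint' hint'', hrefl] at hsum
  linarith

theorem ConvexOn.antitoneOn_add_reflection {g : ℝ → ℝ} {a h : ℝ}
    (hg : ConvexOn ℝ (Ioo a (a + 2 * h)) g) :
    AntitoneOn (fun s => g (a + s) + g (a + (2 * h - s))) (Ioo 0 h) := by
  intro s hs t ht hst
  obtain ⟨hs0, hsh⟩ := hs
  obtain ⟨ht0, hth⟩ := ht
  have hx : a + s ∈ Ioo a (a + 2 * h) := ⟨by linarith, by linarith⟩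
  have hy : a + (2 * h - s) ∈ Ioo a (a + 2 * h) := ⟨by linarith, by linarith⟩
  have hd : 0 < 2 * h - 2 * s := by linarith
  -- With weight `c`, both `a + t` and its mirror image are convex combinations of `a + s` and its
  -- mirror image, with the weights exchanged; adding the two convexity inequalities eliminates `c`.
  set c := (t - s) / (2 * h - 2 * s) with hc
  have hc0 : 0 ≤ c := div_nonneg (by linarith) hd.le
  have hc1 : 0 ≤ 1 - c := by
    rw [sub_nonneg, hc, div_le_one hd]; linarith
  have hmul : c * (2 * h - 2 * s) = t - s := div_mul_cancel₀ _ hd.ne'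
  have h1 := hg.2 hx hy hc1 hc0 (by ring)
  have h2 := hg.2 hx hy hc0 hc1 (by ring)
  simp only [smul_eq_mul] at h1 h2
  rw [show (1 - c) * (a + s) + c * (a + (2 * h - s)) = a + t by linear_combination hmul] at h1
  rw [show c * (a + s) + (1 - c) * (a + (2 * h - s)) = a + (2 * h - t) by
    linear_combination -hmul] at h2
  simp only
  linarith

/-- The cosine is even about the midpoint of its period, so the integral folds onto half a period;
there the folded convex function is nonincreasing. -/
theorem integral_cos_mul_nonneg_of_convexOn {g : ℝ → ℝ} {a h : ℝ} (hh : 0 < h)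
    (hint : IntervalIntegrable (fun s => g (a + s)) volume 0 (2 * h))
    (hg : ConvexOn ℝ (Ioo a (a + 2 * h)) g) :
    0 ≤ ∫ s in (0 : ℝ)..2 * h, Real.cos (Real.pi / h * s) * g (a + s) := by
  have hh2 : h ∈ uIcc 0 (2 * h) := by rw [uIcc_of_le (by linarith)]; exact ⟨hh.le, by linarith⟩
  have hi1 : IntervalIntegrable (fun s => g (a + s)) volume 0 h :=
    hint.mono_set (uIcc_subset_uIcc left_mem_uIcc hh2)
  have hi2 : IntervalIntegrable (fun s => g (a + s)) volume h (2 * h) :=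
    hint.mono_set (uIcc_subset_uIcc hh2 right_mem_uIcc)
  have hi3 := (hi2.comp_sub_left (2 * h)).symm
  rw [sub_self, show 2 * h - h = h by ring] at hi3
  have hC : ∀ c d, ContinuousOn (fun s => Real.cos (Real.pi / h * s)) (uIcc c d) := by
    intro c d; fun_prop
  have key := integral_cos_mul_nonneg_of_antitoneOn hh (hi1.add hi3)
    (ConvexOn.antitoneOn_add_reflection hg)
  have hcos : ∀ s, Real.cos (Real.pi / h * (2 * h - s)) = Real.cos (Real.pi / h * s) := fun s => by
    rw [← Real.cos_two_pi_sub]; congr 1; field_simp; ring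
  have hrefl := intervalIntegral.integral_comp_sub_left (a := 0) (b := h)
    (fun s => Real.cos (Real.pi / h * s) * g (a + s)) (2 * h)
  rw [sub_zero, show 2 * h - h = h by ring] at hrefl
  simp only [hcos] at hrefl
  rw [← intervalIntegral.integral_add_adjacent_intervals (hi1.continuousOn_mul (hC _ _))
    (hi2.continuousOn_mul (hC _ _)), ← hrefl,
    ← intervalIntegral.integral_add (hi1.continuousOn_mul (hC _ _))
    (hi3.continuousOn_mul (hC _ _))]
  simpa only [Pi.add_apply, mul_add] using! key

theorem integral_Ioi_cos_mul_nonneg_of_convexOn {g : ℝ → ℝ} {ω : ℝ} (hω : 0 < ω)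
    (hint : IntegrableOn g (Ioi 0)) (hg : ConvexOn ℝ (Ioi 0) g) :
    0 ≤ ∫ s in Ioi (0 : ℝ), Real.cos (ω * s) * g s := by
  set h := Real.pi / ω with hh
  have hh0 : 0 < h := div_pos Real.pi_pos hω
  have hωh : Real.pi / h = ω := by rw [hh]; field_simp
  have hcosint : IntegrableOn (fun s => Real.cos (ω * s) * g s) (Ioi 0) :=
    hint.bdd_mul (c := 1) (by fun_prop) (by
      filter_upwards with s using by simpa using Real.abs_cos_le_one _)
  have hii : ∀ f : ℝ → ℝ, IntegrableOn f (Ioi 0) → ∀ a b, 0 ≤ a → a ≤ b →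
      IntervalIntegrable f volume a b := fun f hf a b ha hab =>
    (intervalIntegrable_iff_integrableOn_Ioc_of_le hab).2
      (hf.mono_set fun x hx => lt_of_le_of_lt ha hx.1)
  have htend : Tendsto (fun n : ℕ => (n : ℝ) * (2 * h)) atTop atTop :=
    tendsto_natCast_atTop_atTop.atTop_mul_const (by positivity)
  -- The half-line is exhausted by whole periods `2h = 2π/ω`, each contributing a nonnegative
  -- amount.
  refine ge_of_tendsto' (intervalIntegral_tendsto_integral_Ioi 0 hcosint htend) fun n => ?_
  induction n with
  | zero => simp
  | succ n ih =>
    have hn : (0 : ℝ) ≤ n * (2 * h) := by positivity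
    have hnn : (n : ℝ) * (2 * h) + 2 * h = ((n + 1 : ℕ) : ℝ) * (2 * h) := by push_cast; ring
    rw [← intervalIntegral.integral_add_adjacent_intervals
      (hii _ hcosint _ _ le_rfl hn) (hii _ hcosint _ (((n + 1 : ℕ) : ℝ) * (2 * h)) hn
        (by rw [← hnn]; linarith))]
    refine add_nonneg ih ?_
    have hI := (hii _ hint _ _ hn
      (by linarith : (n : ℝ) * (2 * h) ≤ n * (2 * h) + 2 * h)).comp_add_left
      (n * (2 * h))
    simp only [sub_self, add_sub_cancel_left] at hI
    have := integral_cos_mul_nonneg_of_convexOn hh0 hI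
      (hg.subset (fun x hx => lt_of_le_of_lt hn hx.1) (convex_Ioo _ _))
    have hcos : ∀ s, Real.cos (Real.pi / h * s) = Real.cos (ω * (n * (2 * h) + s)) := fun s => by
      rw [hωh, ← Real.cos_add_nat_mul_two_pi _ n]
      congr 1
      rw [hh]; field_simp; ring
    simp only [hcos] at this
    rw [intervalIntegral.integral_comp_add_left
      (fun s => Real.cos (ω * s) * g s) (n * (2 * h)), add_zero, hnn] at this
    exact this

end CosineIntegral

end Viscoelastic

namespace Viscoelastic

noncomputable section

/-! ### Existence and positivity of the boundary value of the Laplace transform. -/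

section AbelLimit

/-- The kernel `exp(-εs + iωs)` of the Laplace transform at the point `ε - iω`. -/
def dampedKernel (ω ε s : ℝ) : ℂ := Complex.exp ((-ε + Complex.I * ω) * s)

theorem norm_dampedKernel (ω ε s : ℝ) : ‖dampedKernel ω ε s‖ = Real.exp (-ε * s) := by
  simp [dampedKernel, Complex.norm_exp]

theorem dampedKernel_re (ω ε s : ℝ) :
    (dampedKernel ω ε s).re = Real.cos (ω * s) * Real.exp (-ε * s) := by
  simp [dampedKernel, Complex.exp_re, mul_comm]

theorem dampedKernel_eq (ω ε s : ℝ) :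
    dampedKernel ω ε s = Real.exp (-ε * s) * Complex.exp (Complex.I * ω * s) := by
  rw [dampedKernel, Complex.ofReal_exp, ← Complex.exp_add]
  congr 1; push_cast; ring

@[fun_prop]
theorem continuous_dampedKernel (ω ε : ℝ) : Continuous (dampedKernel ω ε) := by
  unfold dampedKernel; fun_prop

theorem continuous_dampedKernel_left (ω s : ℝ) : Continuous fun ε => dampedKernel ω ε s := by
  unfold dampedKernel; fun_prop

/-- The Laplace transform of `g` at the point `ε - iω`. -/
def dampedTransform (ω : ℝ) (g : ℝ → ℝ) (ε : ℝ) : ℂ :=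
  ∫ s in Ioi (0 : ℝ), dampedKernel ω ε s * g s

/-- The Laplace transform of `g` converges absolutely in the right half-plane, and it has the
boundary value `L` at `-iω`. -/
def HasAbelTransform (ω : ℝ) (g : ℝ → ℝ) (L : ℂ) : Prop :=
  (∀ ε, 0 < ε → IntegrableOn (fun s => dampedKernel ω ε s * g s) (Ioi 0)) ∧
    Tendsto (dampedTransform ω g) (𝓝[>] 0) (𝓝 L)

theorem tendsto_setIntegral_dampedKernel_mul (ω : ℝ) {g : ℝ → ℝ} {S : Set ℝ} (hS : S ⊆ Ioi 0)
    (hSm : MeasurableSet S) (hg : IntegrableOn g S) :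
    Tendsto (fun ε => ∫ s in S, dampedKernel ω ε s * g s) (𝓝[>] 0)
      (𝓝 (∫ s in S, dampedKernel ω 0 s * g s)) := by
  refine tendsto_integral_filter_of_dominated_convergence (fun s => ‖g s‖) ?_ ?_ hg.norm ?_
  · filter_upwards with ε
    exact (by fun_prop : Continuous (dampedKernel ω ε)).aestronglyMeasurable.mul
      (Complex.continuous_ofReal.comp_aestronglyMeasurable hg.aestronglyMeasurable)
  · filter_upwards [self_mem_nhdsWithin] with ε hε
    filter_upwards [ae_restrict_mem hSm] with s hs
    rw [norm_mul, norm_dampedKernel, Complex.norm_real]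
    refine mul_le_of_le_one_left (norm_nonneg _) (Real.exp_le_one_iff.2 ?_)
    have := mul_pos (mem_Ioi.1 hε) (mem_Ioi.1 (hS hs))
    linarith
  · filter_upwards with s
    exact (((continuous_dampedKernel_left ω s).tendsto 0).mono_left nhdsWithin_le_nhds).mul_const _

/-- Local integrability controls a possible singularity at `0`; beyond `1` the function is bounded
by `f 1`. -/
theorem integrableOn_Ioi_exp_mul_of_antitoneOn {f : ℝ → ℝ} (hf : LocallyIntegrableOn f (Ici 0))
    (h0 : ∀ t, 0 < t → 0 ≤ f t) (hanti : AntitoneOn f (Ioi 0)) {ε : ℝ} (hε : 0 < ε) :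
    IntegrableOn (fun s => Real.exp (-ε * s) * f s) (Ioi 0) := by
  have hIcc : IntegrableOn f (Icc 0 1) :=
    hf.integrableOn_compact_subset Icc_subset_Ici_self isCompact_Icc
  rw [← Ioc_union_Ioi_eq_Ioi (zero_le_one' ℝ)]
  refine IntegrableOn.union ?_ ?_
  · exact (hIcc.continuousOn_mul (by fun_prop) isCompact_Icc).mono_set Ioc_subset_Icc_self
  · refine (integrableOn_exp_mul_Ioi (neg_lt_zero.2 hε) 1).mul_bdd (c := f 1) ?_ ?_
    · exact (hf.mono_set (Ioi_subset_Ici zero_le_one)).aestronglyMeasurable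
    · filter_upwards [ae_restrict_mem measurableSet_Ioi] with s hs
      have hs0 : (0 : ℝ) < s := zero_lt_one.trans hs
      rw [Real.norm_of_nonneg (h0 s hs0)]
      exact hanti (mem_Ioi.2 one_pos) (mem_Ioi.2 hs0) (mem_Ioi.1 hs).le

theorem integrableOn_dampedKernel_mul {f : ℝ → ℝ} {ω ε : ℝ} {S : Set ℝ}
    (h : IntegrableOn (fun s => Real.exp (-ε * s) * f s) S) :
    IntegrableOn (fun s => dampedKernel ω ε s * f s) S := by
  have := Integrable.bdd_mul (Integrable.ofReal (𝕜 := ℂ) h)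
    (f := fun s : ℝ => Complex.exp (Complex.I * ω * s)) (c := 1)
    (Continuous.aestronglyMeasurable (by fun_prop))
    (by filter_upwards with s; simp [Complex.norm_exp])
  refine this.congr ?_
  filter_upwards with s
  rw [dampedKernel_eq]; simp; ring

/-- The difference is nonnegative and its integral telescopes: over `[0, n]` it equals `∫_0^h f -
∫_n^{n+h} f`, at most `∫_0^h f`. -/
theorem integrableOn_Ioi_sub_shift_of_antitoneOn {f : ℝ → ℝ} (hf : LocallyIntegrableOn f (Ici 0))
    (h0 : ∀ t, 0 < t → 0 ≤ f t) (hanti : AntitoneOn f (Ioi 0)) {h : ℝ} (hh : 0 < h) :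
    IntegrableOn (fun s => f s - f (s + h)) (Ioi 0) := by
  have hii : ∀ a b, 0 ≤ a → a ≤ b → IntervalIntegrable f volume a b := fun a b ha hab =>
    (intervalIntegrable_iff_integrableOn_Ioc_of_le hab).2
      ((hf.integrableOn_compact_subset (fun x hx => ha.trans hx.1) isCompact_Icc).mono_set
        Ioc_subset_Icc_self)
  have hshift : ∀ b, 0 ≤ b → IntervalIntegrable (fun s => f (s + h)) volume 0 b := fun b hb => by
    simpa using (hii h (b + h) hh.le (by linarith)).comp_add_right h
  have hDi : ∀ b, 0 ≤ b → IntervalIntegrable (fun s => f s - f (s + h)) volume 0 b := fun b hb =>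
    (hii 0 b le_rfl hb).sub (hshift b hb)
  refine integrableOn_Ioi_of_intervalIntegral_norm_bounded (∫ s in (0 : ℝ)..h, f s) 0
    (b := fun n : ℕ => (n : ℝ)) (l := atTop) (fun n => ?_) tendsto_natCast_atTop_atTop ?_
  · exact (intervalIntegrable_iff_integrableOn_Ioc_of_le (Nat.cast_nonneg n)).1
      (hDi n (Nat.cast_nonneg n))
  · filter_upwards with n
    have hn : (0 : ℝ) ≤ n := Nat.cast_nonneg n
    have e1 : ∫ s in (0 : ℝ)..n, ‖f s - f (s + h)‖ = ∫ s in (0 : ℝ)..n, (f s - f (s + h)) := by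
      refine intervalIntegral.integral_congr_ae ?_
      filter_upwards with s hs
      rw [uIoc_of_le hn] at hs
      exact Real.norm_of_nonneg (sub_nonneg.2
        (hanti hs.1 (mem_Ioi.2 (by linarith [hs.1])) (by linarith)))
    rw [e1, intervalIntegral.integral_sub (hii 0 n le_rfl hn) (hshift n hn),
      intervalIntegral.integral_comp_add_right, zero_add]
    have e2 := intervalIntegral.integral_add_adjacent_intervals
      (hii 0 n le_rfl hn) (hii n (n + h) hn (by linarith))
    have e3 := intervalIntegral.integral_add_adjacent_intervals
      (hii 0 h le_rfl hh.le) (hii h (n + h) hh.le (by linarith))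
    have e4 : 0 ≤ ∫ s in (n : ℝ)..(n + h), f s := by
      rw [intervalIntegral.integral_of_le (by linarith)]
      exact setIntegral_nonneg measurableSet_Ioc fun s hs => h0 s (hn.trans_lt hs.1)
    linarith

theorem setIntegral_Ioi_comp_add_right (F : ℝ → ℂ) (h : ℝ) :
    ∫ s in Ioi (0 : ℝ), F (s + h) = ∫ s in Ioi h, F s := by
  have := (measurePreserving_add_right (volume : Measure ℝ) h).setIntegral_preimage_emb
    (measurableEmbedding_addRight h) F (Ioi h)
  simpa using this

theorem integrableOn_Ioi_comp_add_right {F : ℝ → ℂ} {h : ℝ} (hF : IntegrableOn F (Ioi h)) :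
    IntegrableOn (fun s => F (s + h)) (Ioi 0) := by
  have := ((measurePreserving_add_right (volume : Measure ℝ) h).integrableOn_comp_preimage
    (measurableEmbedding_addRight h) (f := F) (s := Ioi h)).2 hF
  simpa [Function.comp_def] using this

theorem dampedKernel_half_period (ω ε s : ℝ) (hω : 0 < ω) :
    dampedKernel ω ε s =
      -(Real.exp (ε * (Real.pi / ω)) : ℂ) * dampedKernel ω ε (s + Real.pi / ω) := by
  have hω' : (ω : ℂ) ≠ 0 := Complex.ofReal_ne_zero.2 hω.ne'
  have : dampedKernel ω ε (s + Real.pi / ω) = dampedKernel ω ε s *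
      (Complex.exp (-(ε * (Real.pi / ω) : ℝ)) * Complex.exp (Real.pi * Complex.I)) := by
    unfold dampedKernel
    rw [← Complex.exp_add, ← Complex.exp_add]
    congr 1; push_cast; field_simp
  rw [this, Complex.exp_pi_mul_I, Complex.ofReal_exp, Complex.exp_neg]
  field_simp [Complex.exp_ne_zero]

/-- A shift by `h = π/ω` reverses the sign of the oscillation. Hence the transform `F` of `f` and
the transform `D` of `f s - f (s + h)` satisfy `D = F + exp(εh) (F - ∫_0^h)`. Solving for `F` leaves
only integrals of integrable functions, which converge by domination, over `1 + exp(εh)`, which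
tends to `2`. -/
theorem exists_hasAbelTransform_of_antitoneOn {f : ℝ → ℝ} (hf : LocallyIntegrableOn f (Ici 0))
    (h0 : ∀ t, 0 < t → 0 ≤ f t) (hanti : AntitoneOn f (Ioi 0)) {ω : ℝ} (hω : 0 < ω) :
    ∃ L, HasAbelTransform ω f L := by
  have hint : ∀ ε, 0 < ε → IntegrableOn (fun s => dampedKernel ω ε s * f s) (Ioi 0) :=
    fun ε hε => integrableOn_dampedKernel_mul
      (integrableOn_Ioi_exp_mul_of_antitoneOn hf h0 hanti hε)
  set h := Real.pi / ω with hh_def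
  have hh : 0 < h := div_pos Real.pi_pos hω
  have hD := integrableOn_Ioi_sub_shift_of_antitoneOn hf h0 hanti hh
  have hIoc : IntegrableOn f (Ioc 0 h) :=
    (hf.integrableOn_compact_subset Icc_subset_Ici_self isCompact_Icc).mono_set Ioc_subset_Icc_self
  have t1 := tendsto_setIntegral_dampedKernel_mul ω subset_rfl measurableSet_Ioi hD
  have t2 := tendsto_setIntegral_dampedKernel_mul ω Ioc_subset_Ioi_self measurableSet_Ioc hIoc
  have t3 : Tendsto (fun ε : ℝ => (Real.exp (ε * h) : ℂ)) (𝓝[>] 0) (𝓝 1) := by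
    have : Continuous fun ε : ℝ => (Real.exp (ε * h) : ℂ) := by fun_prop
    simpa using (this.tendsto 0).mono_left nhdsWithin_le_nhds
  refine ⟨_, hint, ((t1.add (t3.mul t2)).div (t3.const_add 1)
    (by norm_num : (1 : ℂ) + 1 ≠ 0)).congr' ?_⟩
  filter_upwards [self_mem_nhdsWithin] with ε hε
  have hI := hint ε hε
  have hIh : IntegrableOn (fun s => dampedKernel ω ε s * f s) (Ioi h) :=
    hI.mono_set (Ioi_subset_Ioi hh.le)
  have hshift : ∀ s, dampedKernel ω ε s * f (s + h) =
      -(Real.exp (ε * h) : ℂ) * (dampedKernel ω ε (s + h) * f (s + h)) := fun s => by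
    rw [dampedKernel_half_period ω ε s hω, mul_assoc]
  have hIs := (integrableOn_Ioi_comp_add_right hIh).const_mul (-(Real.exp (ε * h) : ℂ))
  have e1 : ∫ s in Ioi (0 : ℝ), dampedKernel ω ε s * ((f s - f (s + h) : ℝ) : ℂ) =
      dampedTransform ω f ε + Real.exp (ε * h) * ∫ s in Ioi h, dampedKernel ω ε s * f s := by
    simp only [Complex.ofReal_sub, mul_sub, hshift]
    rw [integral_sub hI hIs, integral_const_mul, setIntegral_Ioi_comp_add_right
      (fun s => dampedKernel ω ε s * f s)]
    simp [dampedTransform]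
  have e2 : dampedTransform ω f ε = (∫ s in Ioc 0 h, dampedKernel ω ε s * f s) +
      ∫ s in Ioi h, dampedKernel ω ε s * f s := by
    rw [dampedTransform, ← Ioc_union_Ioi_eq_Ioi hh.le]
    exact setIntegral_union (Ioc_disjoint_Ioi le_rfl) measurableSet_Ioi
      (hI.mono_set Ioc_subset_Ioi_self) hIh
  have hne : (1 : ℂ) + Real.exp (ε * h) ≠ 0 := by
    rw [← Complex.ofReal_one, ← Complex.ofReal_add, Complex.ofReal_ne_zero]
    positivity
  simp only [Pi.div_apply]
  rw [div_eq_iff hne, e1, e2]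
  ring

theorem HasAbelTransform.re_nonneg_of_convexOn {f : ℝ → ℝ} {ω : ℝ} {L : ℂ}
    (hL : HasAbelTransform ω f L) (hω : 0 < ω) (hf : LocallyIntegrableOn f (Ici 0))
    (hconv : NonnegAntitoneConvex f) : 0 ≤ L.re := by
  obtain ⟨h0, hanti, hc⟩ := hconv
  refine ge_of_tendsto ((Complex.continuous_re.tendsto L).comp hL.2) ?_
  filter_upwards [self_mem_nhdsWithin] with ε hε
  have hε : 0 < ε := hε
  have hexp : AntitoneOn (fun s => Real.exp (-ε * s)) (Ioi 0) := fun s _ t _ hst =>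
    Real.exp_le_exp.2 (by nlinarith)
  have hexpc : ConvexOn ℝ (Ioi 0) fun s => Real.exp (-ε * s) :=
    ((convexOn_exp.comp_linearMap (LinearMap.mul ℝ ℝ (-ε))).subset (subset_univ _)
      (convex_Ioi 0))
  -- A product of nonnegative convex functions is convex when they vary in the same direction; here
  -- both are nonincreasing.
  have hprod : ConvexOn ℝ (Ioi 0) fun s => Real.exp (-ε * s) * f s :=
    hexpc.mul hc (fun s _ => (Real.exp_pos _).le) (fun s hs => h0 s hs) (hexp.monovaryOn hanti)
  have := integral_Ioi_cos_mul_nonneg_of_convexOn hω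
    (integrableOn_Ioi_exp_mul_of_antitoneOn hf h0 hanti hε) hprod
  have e : (dampedTransform ω f ε).re = ∫ s in Ioi (0 : ℝ), (dampedKernel ω ε s * f s).re :=
    (integral_re (hL.1 ε hε)).symm
  simp only [Function.comp_apply]
  rw [e]
  simpa only [Complex.re_mul_ofReal, dampedKernel_re, mul_assoc] using this

/-- Together with `HasAbelTransform.congr`, this transfers the symmetries of `G t`, known only for
`t > 0`, to the boundary values. -/
theorem HasAbelTransform.unique {ω : ℝ} {g : ℝ → ℝ} {L M : ℂ} (hL : HasAbelTransform ω g L)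
    (hM : HasAbelTransform ω g M) : L = M :=
  tendsto_nhds_unique hL.2 hM.2

theorem HasAbelTransform.congr {ω : ℝ} {g g' : ℝ → ℝ} {L : ℂ} (hL : HasAbelTransform ω g L)
    (h : ∀ t, 0 < t → g t = g' t) : HasAbelTransform ω g' L := by
  have e : ∀ ε, EqOn (fun s => dampedKernel ω ε s * (g s : ℂ))
      (fun s => dampedKernel ω ε s * (g' s : ℂ)) (Ioi 0) := fun ε s hs => by
    simp only [h s hs]
  refine ⟨fun ε hε => (hL.1 ε hε).congr_fun (e ε) measurableSet_Ioi, hL.2.congr fun ε => ?_⟩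
  exact setIntegral_congr_fun measurableSet_Ioi (e ε)

theorem HasAbelTransform.add {ω : ℝ} {g g' : ℝ → ℝ} {L M : ℂ} (hL : HasAbelTransform ω g L)
    (hM : HasAbelTransform ω g' M) : HasAbelTransform ω (fun s => g s + g' s) (L + M) := by
  refine ⟨fun ε hε => ((hL.1 ε hε).add (hM.1 ε hε)).congr ?_, (hL.2.add hM.2).congr' ?_⟩
  · filter_upwards with s using by simp [mul_add]
  · filter_upwards [self_mem_nhdsWithin] with ε hε
    simp only [dampedTransform, Complex.ofReal_add, mul_add]
    exact (integral_add (hL.1 ε hε) (hM.1 ε hε)).symm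

theorem HasAbelTransform.const_mul {ω : ℝ} {g : ℝ → ℝ} {L : ℂ} (hL : HasAbelTransform ω g L)
    (c : ℝ) : HasAbelTransform ω (fun s => c * g s) (c * L) := by
  have e : ∀ ε s, dampedKernel ω ε s * ((c * g s : ℝ) : ℂ) = c * (dampedKernel ω ε s * g s) :=
    fun ε s => by push_cast; ring
  refine ⟨fun ε hε => by
    simp only [e]; exact Integrable.const_mul (hL.1 ε hε) (c : ℂ),
    (hL.2.const_mul (c : ℂ)).congr fun ε => ?_⟩
  simp only [dampedTransform, e, integral_const_mul]

theorem HasAbelTransform.sum {ω : ℝ} {ι : Type*} (s : Finset ι) {g : ι → ℝ → ℝ} {L : ι → ℂ}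
    (h : ∀ i ∈ s, HasAbelTransform ω (g i) (L i)) :
    HasAbelTransform ω (fun t => ∑ i ∈ s, g i t) (∑ i ∈ s, L i) := by
  classical
  induction s using Finset.induction_on with
  | empty =>
    refine ⟨fun ε _ => by simp, ?_⟩
    have : dampedTransform ω (fun _ => 0) = fun _ => 0 := by ext; simp [dampedTransform]
    simp [this]
  | insert i s hi ih =>
    simp only [Finset.sum_insert hi]
    exact (h i (Finset.mem_insert_self i s)).add
      (ih fun j hj => h j (Finset.mem_insert_of_mem hj))

end AbelLimit

end

end Viscoelastic

namespace Viscoelastic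

noncomputable section

/-! ### Algebra of tensors of rank four. -/

section BilinearForm

variable {d : ℕ} {R : Type*} [CommRing R]

/-- The bilinear form `∑ u_{kl} A_{klmn} v_{mn}` of a tensor of rank four. -/
def tensorForm (A : Fin d → Fin d → Fin d → Fin d → R) (u v : Matrix (Fin d) (Fin d) R) : R :=
  ∑ k, ∑ l, ∑ m, ∑ n, u k l * A k l m n * v m n

variable (A : Fin d → Fin d → Fin d → Fin d → R) (u u' v v' : Matrix (Fin d) (Fin d) R)

theorem tensorForm_add_left : tensorForm A (u + u') v = tensorForm A u v + tensorForm A u' v := by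
  simp only [tensorForm, Matrix.add_apply, add_mul, Finset.sum_add_distrib]

theorem tensorForm_add_right : tensorForm A u (v + v') = tensorForm A u v + tensorForm A u v' := by
  simp only [tensorForm, Matrix.add_apply, mul_add, Finset.sum_add_distrib]

theorem tensorForm_smul_left (c : R) : tensorForm A (c • u) v = c * tensorForm A u v := by
  simp only [tensorForm, Matrix.smul_apply, smul_eq_mul, Finset.mul_sum, mul_assoc]

theorem tensorForm_smul_right (c : R) : tensorForm A u (c • v) = c * tensorForm A u v := by
  simp only [tensorForm, Matrix.smul_apply, smul_eq_mul, Finset.mul_sum]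
  congr! 4
  ring

theorem tensorForm_single (k l m n : Fin d) :
    tensorForm A (Matrix.single k l 1) (Matrix.single m n 1) = A k l m n := by
  simp [tensorForm, Matrix.single_apply, ite_and]

variable {A}

theorem tensorForm_transpose_left (hA : ∀ k l m n, A k l m n = A l k m n) :
    tensorForm A u.transpose v = tensorForm A u v := by
  unfold tensorForm
  rw [Finset.sum_comm]
  simp only [Matrix.transpose_apply]
  congr! 6 with k _ l _ m _ n
  exact hA _ _ _ _

theorem tensorForm_transpose_right (hA : ∀ k l m n, A k l m n = A k l n m) :
    tensorForm A u v.transpose = tensorForm A u v := by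
  unfold tensorForm
  congr! 2 with k _ l _
  rw [Finset.sum_comm]
  simp only [Matrix.transpose_apply]
  congr! 3 with m _ n _
  exact congrArg _ (hA _ _ _ _)

theorem tensorForm_comm (hA : ∀ k l m n, A k l m n = A m n k l) :
    tensorForm A u v = tensorForm A v u := by
  have h : ∀ u v : Matrix (Fin d) (Fin d) R, tensorForm A u v =
      ∑ p : Fin d × Fin d, ∑ q : Fin d × Fin d, u p.1 p.2 * A p.1 p.2 q.1 q.2 * v q.1 q.2 := by
    intro u v
    simp only [tensorForm, Fintype.sum_prod_type]
  rw [h, h, Finset.sum_comm]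
  congr! 2 with p _ q _
  rw [hA q.1 q.2 p.1 p.2]
  ring

theorem tensorForm_polarization (hA : ∀ k l m n, A k l m n = A m n k l) :
    4 * tensorForm A u v =
      tensorForm A (u + v) (u + v) - tensorForm A (u + (-1 : R) • v) (u + (-1 : R) • v) := by
  simp only [tensorForm_add_left, tensorForm_add_right, tensorForm_smul_left,
    tensorForm_smul_right]
  rw [tensorForm_comm v u hA]
  ring

/-- A symmetric complex tensor whose real part is nonnegative on the real symmetric matrices gives
a sesquilinear form with nonnegative real part on all complex matrices. -/
theorem tensorForm_conj_re_nonneg {A : Fin d → Fin d → Fin d → Fin d → ℂ}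
    (hl : ∀ k l m n, A k l m n = A l k m n) (hr : ∀ k l m n, A k l m n = A k l n m)
    (hm : ∀ k l m n, A k l m n = A m n k l)
    (hpos : ∀ e : Matrix (Fin d) (Fin d) ℝ, e.IsSymm →
      0 ≤ (tensorForm A (e.map (↑)) (e.map (↑))).re) (w : Matrix (Fin d) (Fin d) ℂ) :
    0 ≤ (tensorForm A (w.map star) w).re := by
  -- Symmetry of `e` can be dropped: by the minor symmetries the form at `e + eᵀ` is four times the
  -- form at `e`.
  have hpos' : ∀ e : Matrix (Fin d) (Fin d) ℝ,
      0 ≤ (tensorForm A (e.map (↑)) (e.map (↑))).re := fun e => by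
    have h := hpos (e + e.transpose) (by
      rw [Matrix.IsSymm, Matrix.transpose_add, Matrix.transpose_transpose, add_comm])
    have hmap : (e + e.transpose).map ((↑) : ℝ → ℂ) =
        e.map (↑) + (e.map ((↑) : ℝ → ℂ)).transpose := by ext; simp
    rw [hmap, tensorForm_add_left, tensorForm_add_right, tensorForm_add_right,
      tensorForm_transpose_left _ _ hl, tensorForm_transpose_left _ _ hl,
      tensorForm_transpose_right _ _ hr] at h
    simp only [Complex.add_re] at h
    linarith
  have h1 : w = (w.map Complex.re).map (↑) + Complex.I • (w.map Complex.im).map (↑) := by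
    ext i j; simp [mul_comm Complex.I, Complex.re_add_im]
  have h2 : w.map star = (w.map Complex.re).map (↑) + (-Complex.I) • (w.map Complex.im).map (↑) := by
    ext i j; apply Complex.ext <;> simp
  -- The major symmetry cancels the cross terms between the real and imaginary parts of `w`.
  have key : tensorForm A (w.map star) w =
      tensorForm A ((w.map Complex.re).map (↑)) ((w.map Complex.re).map (↑)) +
      tensorForm A ((w.map Complex.im).map (↑)) ((w.map Complex.im).map (↑)) := by
    rw [h2]
    nth_rewrite 3 [h1]
    simp only [tensorForm_add_left, tensorForm_add_right, tensorForm_smul_left,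
      tensorForm_smul_right]
    rw [tensorForm_comm ((w.map Complex.im).map (↑)) ((w.map Complex.re).map (↑)) hm]
    linear_combination (-tensorForm A ((w.map Complex.im).map (↑)) ((w.map Complex.im).map (↑))) *
      Complex.I_mul_I
  rw [key, Complex.add_re]
  exact add_nonneg (hpos' _) (hpos' _)

end BilinearForm

/-! ### From the quadratic forms of the modulus to its entries. -/

section Modulus

variable {d : ℕ} {G : TensorFun d}

theorem quadForm_eq_tensorForm (e : Matrix (Fin d) (Fin d) ℝ) (t : ℝ) :
    quadForm G e t = tensorForm (G t) e e := rfl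

theorem IsRelaxationModulus.locallyIntegrableOn_quadForm (hG : IsRelaxationModulus G)
    (e : Matrix (Fin d) (Fin d) ℝ) : LocallyIntegrableOn (quadForm G e) (Ici 0) := by
  rw [locallyIntegrableOn_iff isClosed_Ici.isLocallyClosed]
  intro K hK hKc
  unfold quadForm
  refine integrable_finsetSum _ fun k _ => integrable_finsetSum _ fun l _ =>
    integrable_finsetSum _ fun m _ => integrable_finsetSum _ fun n _ => ?_
  exact (((hG.locallyIntegrable k l m n).integrableOn_compact_subset hK hKc).const_mul
    (e k l)).mul_const (e m n)

/-- Polarization contributes a factor `4`; symmetrizing the two matrix units, so that the forms are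
taken at symmetric matrices, contributes another `4`. -/
theorem IsRelaxationModulus.sixteen_mul_eq (hG : IsRelaxationModulus G) (k l m n : Fin d) {t : ℝ}
    (ht : 0 < t) :
    16 * G t k l m n =
      quadForm G ((Matrix.single k l 1 + Matrix.single l k 1) +
        (Matrix.single m n 1 + Matrix.single n m 1)) t -
      quadForm G ((Matrix.single k l 1 + Matrix.single l k 1) +
        (-1 : ℝ) • (Matrix.single m n 1 + Matrix.single n m 1)) t := by
  rw [quadForm_eq_tensorForm, quadForm_eq_tensorForm,
    ← tensorForm_polarization _ _ (hG.major t ht)]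
  simp only [tensorForm_add_left, tensorForm_add_right, tensorForm_single]
  rw [← hG.minor_left t ht k l m n, ← hG.minor_left t ht k l n m, ← hG.minor_right t ht k l m n]
  ring

theorem isSymm_single_add_single (k l : Fin d) :
    (Matrix.single k l (1 : ℝ) + Matrix.single l k 1).IsSymm := by
  rw [Matrix.IsSymm, Matrix.transpose_add, Matrix.transpose_single, Matrix.transpose_single,
    add_comm]

/-- An entry of `G` need not be monotone, but it is a multiple of a difference of two quadratic
forms, each of which is. -/
theorem IsRelaxationModulus.exists_hasAbelTransform (hG : IsRelaxationModulus G)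
    (hP : InFormSense NonnegAntitoneConvex G) {ω : ℝ} (hω : 0 < ω) (k l m n : Fin d) :
    ∃ L, HasAbelTransform ω (fun t => G t k l m n) L := by
  have h : ∀ e : Matrix (Fin d) (Fin d) ℝ, e.IsSymm →
      ∃ L, HasAbelTransform ω (quadForm G e) L := fun e he =>
    exists_hasAbelTransform_of_antitoneOn (hG.locallyIntegrableOn_quadForm e) (hP e he).1
      (hP e he).2.1 hω
  obtain ⟨L, hL⟩ := h _ ((isSymm_single_add_single k l).add (isSymm_single_add_single m n))
  obtain ⟨M, hM⟩ := h _ ((isSymm_single_add_single k l).add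
    ((isSymm_single_add_single m n).smul (-1 : ℝ)))
  refine ⟨_, (((hL.add (hM.const_mul (-1))).const_mul (1 / 16)).congr fun t ht => ?_)⟩
  linear_combination (-(1 / 16 : ℝ)) * hG.sixteen_mul_eq k l m n ht

theorem HasAbelTransform.tensorForm {ω : ℝ} {A : Fin d → Fin d → Fin d → Fin d → ℂ}
    (hA : ∀ k l m n, HasAbelTransform ω (fun t => G t k l m n) (A k l m n))
    (e : Matrix (Fin d) (Fin d) ℝ) :
    HasAbelTransform ω (quadForm G e) (tensorForm A (e.map (↑)) (e.map (↑))) := by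
  have := HasAbelTransform.sum Finset.univ fun k _ => HasAbelTransform.sum Finset.univ fun l _ =>
    HasAbelTransform.sum Finset.univ fun m _ => HasAbelTransform.sum Finset.univ fun n _ =>
      (hA k l m n).const_mul (e k l * e m n)
  convert this using 1
  · ext t
    simp only [quadForm]
    congr! 4
    ring
  · simp only [Viscoelastic.tensorForm, Matrix.map_apply]
    congr! 4
    push_cast
    ring

end Modulus

end

end Viscoelastic

namespace Viscoelastic

noncomputable section

/-! ### Stress and equation of motion for plane waves. -/

section PlaneWave

variable {d : ℕ}

/-- The complex exponential `exp(-iωt + i k·x)`. -/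
def waveExp (ω : ℝ) (k : Fin d → ℂ) (t : ℝ) (x : Vec d) : ℂ :=
  Complex.exp (-Complex.I * ω * t + Complex.I * ∑ j, k j * (x j : ℂ))

theorem waveExp_ne_zero (ω : ℝ) (k : Fin d → ℂ) (t : ℝ) (x : Vec d) : waveExp ω k t x ≠ 0 :=
  Complex.exp_ne_zero _

theorem waveExp_eq_mul (ω : ℝ) (k : Fin d → ℂ) (t : ℝ) (x : Vec d) :
    waveExp ω k t x = waveExp ω k 0 x * Complex.exp (-Complex.I * ω * t) := by
  rw [waveExp, waveExp, ← Complex.exp_add]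
  congr 1; push_cast; ring

theorem waveExp_sub_time (ω : ℝ) (k : Fin d → ℂ) (t s : ℝ) (x : Vec d) :
    waveExp ω k (t - s) x = waveExp ω k t x * Complex.exp (Complex.I * ω * s) := by
  rw [waveExp, waveExp, ← Complex.exp_add]
  congr 1; push_cast; ring

theorem waveExp_add_smul_single (ω : ℝ) (k : Fin d → ℂ) (t s : ℝ) (x : Vec d) (n : Fin d) :
    waveExp ω k t (x + s • EuclideanSpace.single n 1) =
      waveExp ω k t x * Complex.exp (Complex.I * k n * s) := by
  have h : ∑ j, k j * (((x + s • EuclideanSpace.single n (1 : ℝ)) j : ℝ) : ℂ) =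
      ∑ j, k j * (x j : ℂ) + k n * s := by
    simp [PiLp.single_apply, mul_add, Finset.sum_add_distrib, apply_ite ((↑) : ℝ → ℂ)]
  rw [waveExp, waveExp, ← Complex.exp_add, h]
  congr 1; ring

theorem hasDerivAt_re_mul_exp (c z : ℂ) (t : ℝ) :
    HasDerivAt (fun s : ℝ => (c * Complex.exp (z * s)).re) (c * z * Complex.exp (z * t)).re t := by
  have h := ((((hasDerivAt_id' (t : ℂ)).const_mul z).cexp).const_mul c).real_of_complex
  convert h using 2
  ring

theorem deriv_re_mul_waveExp (ω : ℝ) (k : Fin d → ℂ) (c : ℂ) (t : ℝ) (x : Vec d) :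
    deriv (fun τ => (c * waveExp ω k τ x).re) t =
      (c * (-Complex.I * ω) * waveExp ω k t x).re := by
  have h := hasDerivAt_re_mul_exp (c * waveExp ω k 0 x) (-Complex.I * ω) t
  have e : (fun τ => (c * waveExp ω k τ x).re) = fun τ : ℝ =>
      (c * waveExp ω k 0 x * Complex.exp (-Complex.I * ω * τ)).re := by
    ext τ; rw [waveExp_eq_mul ω k τ x, ← mul_assoc]
  rw [e, h.deriv, waveExp_eq_mul ω k t x]
  congr 1; ring

theorem partialDeriv_re_mul_waveExp (ω : ℝ) (k : Fin d → ℂ) (c : ℂ) (t : ℝ) (x : Vec d)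
    (n : Fin d) :
    partialDeriv n (fun y => (c * waveExp ω k t y).re) x =
      (c * (Complex.I * k n) * waveExp ω k t x).re := by
  have h := hasDerivAt_re_mul_exp (c * waveExp ω k t x) (Complex.I * k n) 0
  rw [partialDeriv, lineDeriv]
  simp only [waveExp_add_smul_single, ← mul_assoc] at h ⊢
  rw [h.deriv]
  simp only [Complex.ofReal_zero, mul_zero, Complex.exp_zero, mul_one]
  congr 1; ring

theorem velocity_planeWave (ω : ℝ) (a k : Fin d → ℂ) (t : ℝ) (x : Vec d) (m : Fin d) :
    velocity (planeWave ω a k) t x m = (a m * (-Complex.I * ω) * waveExp ω k t x).re :=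
  deriv_re_mul_waveExp ω k (a m) t x

variable {G : TensorFun d} {ω : ℝ} {A : Fin d → Fin d → Fin d → Fin d → ℂ}

/-- The complex amplitude of the stress, for the modulus `A` in the frequency domain. -/
def stressAmplitude (ω : ℝ) (A : Fin d → Fin d → Fin d → Fin d → ℂ) (a k : Fin d → ℂ)
    (i j : Fin d) : ℂ :=
  ∑ m, ∑ n, A i j m n * (ω * (a m * k n))

/-- The past state at `t - s` differs from the present one by `exp(iωs)`, which combines with the
convergence factor to give the Laplace kernel. -/
theorem dampedStress_planeWave
    (hA : ∀ k l m n, HasAbelTransform ω (fun t => G t k l m n) (A k l m n)) (a k : Fin d → ℂ)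
    {ε : ℝ} (hε : 0 < ε) (t : ℝ) (x : Vec d) (i j : Fin d) :
    dampedStress G (planeWave ω a k) ε t x i j =
      (stressAmplitude ω (fun k l m n => dampedTransform ω (fun t => G t k l m n) ε) a k i j *
        waveExp ω k t x).re := by
  have hint : ∀ m n, IntegrableOn (fun s => dampedKernel ω ε s * (G s i j m n : ℂ) *
      (ω * (a m * k n) * waveExp ω k t x)) (Ioi 0) := fun m n =>
    Integrable.mul_const ((hA i j m n).1 ε hε) _
  have e : ∀ s, Real.exp (-ε * s) * ∑ m, ∑ n, G s i j m n *
      partialDeriv n (fun y => velocity (planeWave ω a k) (t - s) y m) x =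
      (∑ m, ∑ n, dampedKernel ω ε s * (G s i j m n : ℂ) *
        (ω * (a m * k n) * waveExp ω k t x)).re := fun s => by
    simp only [velocity_planeWave, partialDeriv_re_mul_waveExp, Complex.re_sum, Finset.mul_sum]
    congr! 2 with m _ n _
    rw [waveExp_sub_time, dampedKernel_eq, ← Complex.re_ofReal_mul, ← Complex.re_ofReal_mul]
    congr 1
    linear_combination (-(Real.exp (-ε * s) * G s i j m n * a m * ω * k n * waveExp ω k t x *
      Complex.exp (Complex.I * ω * s) : ℂ)) * Complex.I_mul_I
  have hre := integral_re (𝕜 := ℂ) (integrable_finsetSum Finset.univ fun m _ =>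
    integrable_finsetSum Finset.univ fun n _ => hint m n)
  simp only [dampedStress, e]
  refine hre.trans ?_
  rw [integral_finsetSum _ fun m _ => integrable_finsetSum Finset.univ fun n _ => hint m n]
  simp only [fun m => integral_finsetSum (f := fun n s => dampedKernel ω ε s * (G s i j m n : ℂ) *
    (ω * (a m * k n) * waveExp ω k t x)) Finset.univ fun n _ => hint m n, integral_mul_const]
  simp only [stressAmplitude, dampedTransform, Finset.sum_mul, mul_assoc]
  rfl

theorem tendsto_dampedStress_planeWave
    (hA : ∀ k l m n, HasAbelTransform ω (fun t => G t k l m n) (A k l m n)) (a k : Fin d → ℂ)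
    (t : ℝ) (x : Vec d) (i j : Fin d) :
    Tendsto (fun ε => dampedStress G (planeWave ω a k) ε t x i j) (𝓝[>] 0)
      (𝓝 (stressAmplitude ω A a k i j * waveExp ω k t x).re) := by
  have h : Tendsto (fun ε => stressAmplitude ω
      (fun k l m n => dampedTransform ω (fun t => G t k l m n) ε) a k i j) (𝓝[>] 0)
      (𝓝 (stressAmplitude ω A a k i j)) :=
    tendsto_finsetSum _ fun m _ => tendsto_finsetSum _ fun n _ => (hA i j m n).2.mul_const _
  refine ((Complex.continuous_re.tendsto _).comp (h.mul_const (waveExp ω k t x))).congr' ?_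
  filter_upwards [self_mem_nhdsWithin] with ε hε
  exact (dampedStress_planeWave hA a k hε t x i j).symm

theorem stress_planeWave
    (hA : ∀ k l m n, HasAbelTransform ω (fun t => G t k l m n) (A k l m n)) (a k : Fin d → ℂ)
    (t : ℝ) (x : Vec d) (i j : Fin d) :
    stress G (planeWave ω a k) t x i j = (stressAmplitude ω A a k i j * waveExp ω k t x).re :=
  (tendsto_dampedStress_planeWave hA a k t x i j).limUnder_eq

theorem stressExists_planeWave
    (hA : ∀ k l m n, HasAbelTransform ω (fun t => G t k l m n) (A k l m n)) (a k : Fin d → ℂ) :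
    StressExists G (planeWave ω a k) := fun t x i j => by
  rw [stress_planeWave hA]
  exact tendsto_dampedStress_planeWave hA a k t x i j

theorem eq_zero_of_forall_re_mul_waveExp_eq_zero (hω : 0 < ω) {k : Fin d → ℂ} {x : Vec d} {z : ℂ}
    (h : ∀ t, 0 < t → (z * waveExp ω k t x).re = 0) : z = 0 := by
  have hω' : (ω : ℂ) ≠ 0 := Complex.ofReal_ne_zero.2 hω.ne'
  have hpi := Real.pi_pos
  -- Only `t > 0` is available, so a full period replaces `t = 0` and yields the real part; a
  -- quarter period yields the imaginary part.
  have h1 := h (2 * Real.pi / ω) (by positivity)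
  have h2 := h (Real.pi / 2 / ω) (by positivity)
  have e1 : Complex.exp (-Complex.I * ω * ((2 * Real.pi / ω : ℝ) : ℂ)) = 1 := by
    rw [show -Complex.I * ω * ((2 * Real.pi / ω : ℝ) : ℂ) = -(2 * Real.pi * Complex.I) by
      push_cast; field_simp, Complex.exp_neg, Complex.exp_two_pi_mul_I, inv_one]
  have e2 : Complex.exp (-Complex.I * ω * ((Real.pi / 2 / ω : ℝ) : ℂ)) = -Complex.I := by
    rw [show -Complex.I * ω * ((Real.pi / 2 / ω : ℝ) : ℂ) = -(Real.pi / 2 * Complex.I) by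
      push_cast; field_simp, Complex.exp_neg, Complex.exp_pi_div_two_mul_I, Complex.inv_I]
  rw [waveExp_eq_mul, e1, mul_one] at h1
  rw [waveExp_eq_mul, e2, ← mul_assoc] at h2
  have : z * waveExp ω k 0 x = 0 := by
    apply Complex.ext
    · simpa using h1
    · simpa only [mul_neg, Complex.neg_re, Complex.mul_I_re, neg_neg, Complex.zero_im] using h2
  exact (mul_eq_zero.1 this).resolve_right (waveExp_ne_zero _ _ _ _)

theorem SolvesMotion.amplitude_eq {ρ : ℝ} (hω : 0 < ω)
    (hA : ∀ k l m n, HasAbelTransform ω (fun t => G t k l m n) (A k l m n)) {a k : Fin d → ℂ}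
    (h : SolvesMotion ρ G (planeWave ω a k)) (i : Fin d) :
    ∑ l, stressAmplitude ω A a k i l * k l = Complex.I * (ρ * ω ^ 2) * a i := by
  have key : ρ * (a i * (-Complex.I * ω) * (-Complex.I * ω)) -
      ∑ l, stressAmplitude ω A a k i l * (Complex.I * k l) = 0 := by
    refine eq_zero_of_forall_re_mul_waveExp_eq_zero hω (k := k) (x := 0) fun t ht => ?_
    have := h t ht 0 i
    simp only [velocity_planeWave, stress_planeWave hA, partialDeriv_re_mul_waveExp,
      deriv_re_mul_waveExp] at this
    rw [sub_mul, Complex.sub_re, Finset.sum_mul, Complex.re_sum, ← this, mul_assoc (ρ : ℂ),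
      Complex.re_ofReal_mul, sub_self]
  have e : ∑ l, stressAmplitude ω A a k i l * (Complex.I * k l) =
      Complex.I * ∑ l, stressAmplitude ω A a k i l * k l := by
    rw [Finset.mul_sum]; congr! 1; ring
  rw [e] at key
  linear_combination Complex.I * key + ((∑ l, stressAmplitude ω A a k i l * k l) -
    Complex.I * ρ * ω ^ 2 * a i) * Complex.I_mul_I

end PlaneWave

/-! ### The averaged flux and its component along the attenuation vector. -/

section Flux

variable {d : ℕ} {G : TensorFun d} {ω : ℝ} {A : Fin d → Fin d → Fin d → Fin d → ℂ}

theorem integral_exp_period (hω : 0 < ω) (c : ℂ) :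
    ∫ t in (0 : ℝ)..2 * Real.pi / ω, (c * Complex.exp ((-2 * Complex.I * ω) * t)).re = 0 := by
  have hω' : (ω : ℂ) ≠ 0 := Complex.ofReal_ne_zero.2 hω.ne'
  have hc : -2 * Complex.I * (ω : ℂ) ≠ 0 := by simp [hω.ne']
  have hint : IntervalIntegrable (fun t : ℝ => c * Complex.exp ((-2 * Complex.I * ω) * t)) volume
      0 (2 * Real.pi / ω) := Continuous.intervalIntegrable (by fun_prop) _ _
  have h := Complex.reCLM.intervalIntegral_comp_comm hint
  simp only [Complex.reCLM_apply] at h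
  have e : Complex.exp (-2 * Complex.I * ω * ((2 * Real.pi / ω : ℝ) : ℂ)) = 1 := by
    rw [Complex.exp_eq_one_iff]
    exact ⟨-2, by push_cast; field_simp⟩
  rw [h, intervalIntegral.integral_const_mul, integral_exp_mul_complex hc, e]
  simp

theorem continuous_re_mul_waveExp (k : Fin d → ℂ) (p : ℂ) (x : Vec d) :
    Continuous fun t => (p * waveExp ω k t x).re := by
  unfold waveExp; fun_prop

theorem integral_re_mul_re_waveExp (hω : 0 < ω) (k : Fin d → ℂ) (p q : ℂ) (x : Vec d) :
    ∫ t in (0 : ℝ)..2 * Real.pi / ω, (p * waveExp ω k t x).re * (q * waveExp ω k t x).re =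
      (2 * Real.pi / ω) * (Complex.normSq (waveExp ω k 0 x) / 2 * (p * star q).re) := by
  -- `Re P Re Q = (Re (P conj Q) + Re (P Q)) / 2`: the first term is constant in time, the second
  -- oscillates at frequency `2ω` and averages to zero.
  have e : ∀ t : ℝ, (p * waveExp ω k t x).re * (q * waveExp ω k t x).re =
      Complex.normSq (waveExp ω k 0 x) / 2 * (p * star q).re +
      (p * q * waveExp ω k 0 x ^ 2 / 2 * Complex.exp ((-2 * Complex.I * ω) * t)).re := fun t => by
    have hn : Complex.normSq (waveExp ω k 0 x) = Complex.normSq (waveExp ω k t x) := by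
      rw [waveExp_eq_mul ω k t x, Complex.normSq_mul, Complex.normSq_eq_norm_sq (Complex.exp _),
        Complex.norm_exp]
      simp
    have h2 : p * q * waveExp ω k 0 x ^ 2 / 2 * Complex.exp ((-2 * Complex.I * ω) * t) =
        p * q * waveExp ω k t x ^ 2 / 2 := by
      rw [waveExp_eq_mul ω k t x, mul_pow, ← Complex.exp_nat_mul]
      push_cast
      rw [show (2 : ℂ) * (-Complex.I * ω * t) = -2 * Complex.I * ω * t by ring]
      ring
    rw [h2, hn]
    generalize waveExp ω k t x = z
    simp [Complex.normSq_apply, pow_two]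
    ring
  simp only [e]
  rw [intervalIntegral.integral_add (by simp) (Continuous.intervalIntegrable (by fun_prop) _ _),
    integral_exp_period hω, intervalIntegral.integral_const]
  simp

theorem continuous_energyFlux_planeWave
    (hA : ∀ k l m n, HasAbelTransform ω (fun t => G t k l m n) (A k l m n)) (a k : Fin d → ℂ)
    (x : Vec d) : Continuous fun t => energyFlux G (planeWave ω a k) t x := by
  simp only [energyFlux, stress_planeWave hA, velocity_planeWave]
  refine (PiLp.continuous_toLp 2 _).comp (continuous_pi fun l => ?_)
  exact (continuous_finsetSum _ fun i _ =>
    (continuous_re_mul_waveExp k _ x).mul (continuous_re_mul_waveExp k _ x)).neg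

theorem inner_averageFlux_planeWave (hω : 0 < ω)
    (hA : ∀ k l m n, HasAbelTransform ω (fun t => G t k l m n) (A k l m n)) (a k : Fin d → ℂ)
    (x : Vec d) (v : Vec d) :
    inner ℝ (averageFlux G (planeWave ω a k) (2 * Real.pi / ω) x) v =
      Complex.normSq (waveExp ω k 0 x) / 2 * -∑ l, ∑ i,
        v l * (stressAmplitude ω A a k i l * star (a i * (-Complex.I * ω))).re := by
  have hT : 2 * Real.pi / ω ≠ 0 := by have := Real.pi_pos; positivity
  have hcont := continuous_energyFlux_planeWave hA a k x
  have h := (innerSL ℝ v).intervalIntegral_comp_comm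
    (hcont.intervalIntegrable (μ := volume) 0 (2 * Real.pi / ω))
  simp only [innerSL_apply_apply] at h
  rw [averageFlux, real_inner_smul_left, real_inner_comm, ← h]
  have e : ∀ t, inner ℝ v (energyFlux G (planeWave ω a k) t x) = -∑ l, ∑ i, v l *
      ((stressAmplitude ω A a k i l * waveExp ω k t x).re *
        (a i * (-Complex.I * ω) * waveExp ω k t x).re) := fun t => by
    simp only [energyFlux, stress_planeWave hA, velocity_planeWave, PiLp.inner_apply,
      ← Finset.sum_neg_distrib]
    congr! 1 with l
    rw [Finset.sum_neg_distrib, Finset.sum_neg_distrib, ← Finset.mul_sum, ← mul_neg,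
      RCLike.inner_apply, conj_trivial, mul_comm]
  have hi : ∀ l i, IntervalIntegrable (fun t => v l *
      ((stressAmplitude ω A a k i l * waveExp ω k t x).re *
        (a i * (-Complex.I * ω) * waveExp ω k t x).re)) volume 0 (2 * Real.pi / ω) := fun l i =>
    (continuous_const.mul ((continuous_re_mul_waveExp k _ x).mul
      (continuous_re_mul_waveExp k _ x))).intervalIntegrable _ _
  have hi' : ∀ l, IntervalIntegrable (fun t => ∑ i, v l *
      ((stressAmplitude ω A a k i l * waveExp ω k t x).re *
        (a i * (-Complex.I * ω) * waveExp ω k t x).re)) volume 0 (2 * Real.pi / ω) := fun l =>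
    (continuous_finsetSum _ fun i _ => continuous_const.mul ((continuous_re_mul_waveExp k _ x).mul
      (continuous_re_mul_waveExp k _ x))).intervalIntegrable _ _
  simp only [e]
  rw [intervalIntegral.integral_neg, intervalIntegral.integral_finsetSum fun l _ => hi' l]
  simp only [intervalIntegral.integral_finsetSum fun i _ => hi _ i,
    intervalIntegral.integral_const_mul, integral_re_mul_re_waveExp hω]
  simp only [mul_neg, Finset.mul_sum]
  congr! 3
  field_simp

/-- This rests on `conj k - k = -2i Im k`, applied termwise; it separates a dissipative term from
one governed by the equation of motion. -/
theorem neg_sum_attenuation_mul_eq (S : Fin d → Fin d → ℂ) (a k : Fin d → ℂ) :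
    -∑ l, ∑ i, (k l).im * (S i l * star (a i * (-Complex.I * ω))).re =
      ω / 2 * ((∑ i, ∑ l, star (a i * k l) * S i l).re -
        (∑ i, star (a i) * ∑ l, S i l * k l).re) := by
  rw [Finset.sum_comm, ← Complex.sub_re, ← Finset.sum_sub_distrib, Complex.re_sum,
    Finset.mul_sum, ← Finset.sum_neg_distrib]
  congr! 1 with i
  rw [Finset.mul_sum, ← Finset.sum_sub_distrib, Complex.re_sum, Finset.mul_sum,
    ← Finset.sum_neg_distrib]
  congr! 1 with l
  simp
  ring

theorem fluxAngleAcute_of_nonnegAntitoneConvex (ρ : ℝ) (hG : IsRelaxationModulus G)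
    (hP : InFormSense NonnegAntitoneConvex G) : FluxAngleAcute ρ G := by
  intro ω a k hω
  choose A hA using hG.exists_hasAbelTransform hP hω
  refine ⟨stressExists_planeWave hA a k,
    fun x => (continuous_energyFlux_planeWave hA a k x).intervalIntegrable _ _, fun hM x => ?_⟩
  suffices h : 0 ≤ inner ℝ (averageFlux G (planeWave ω a k) (2 * Real.pi / ω) x)
      (attenuationVector k) from
    -- If one of the vectors is zero, the quotient defining the angle is `0` and the angle is `π/2`,
    -- matching the convention for zero vectors.
    ⟨h, Real.arccos_le_pi_div_two.2 (div_nonneg h (by positivity))⟩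
  rw [inner_averageFlux_planeWave hω hA]
  refine mul_nonneg (div_nonneg (Complex.normSq_nonneg _) zero_le_two) ?_
  have hform := tensorForm_conj_re_nonneg (A := A)
    (fun k l m n => ((hA k l m n).congr fun t ht => hG.minor_left t ht k l m n).unique
      (hA l k m n))
    (fun k l m n => ((hA k l m n).congr fun t ht => hG.minor_right t ht k l m n).unique
      (hA k l n m))
    (fun k l m n => ((hA k l m n).congr fun t ht => hG.major t ht k l m n).unique
      (hA m n k l))
    (fun e he => (HasAbelTransform.tensorForm hA e).re_nonneg_of_convexOn hω
      (hG.locallyIntegrableOn_quadForm e) (hP e he)) (Matrix.of fun m n => a m * k n)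
  have e1 := neg_sum_attenuation_mul_eq (ω := ω) (stressAmplitude ω A a k) a k
  have e2 : ∑ i, ∑ l, star (a i * k l) * stressAmplitude ω A a k i l =
      ω * tensorForm A ((Matrix.of fun m n => a m * k n).map star)
        (Matrix.of fun m n => a m * k n) := by
    simp only [stressAmplitude, tensorForm, Finset.mul_sum, Matrix.map_apply, Matrix.of_apply]
    congr! 4
    ring
  -- By the equation of motion each summand is `i ρ ω² |a_i|²`, which is purely imaginary.
  have e3 : (∑ i, star (a i) * ∑ l, stressAmplitude ω A a k i l * k l).re = 0 := by
    rw [Complex.re_sum]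
    refine Finset.sum_eq_zero fun i _ => ?_
    rw [hM.amplitude_eq hω hA]
    simp [pow_two]
    ring
  simp only [attenuationVector]
  rw [e1, e2, e3, sub_zero, Complex.re_ofReal_mul]
  positivity

end Flux

/-! ### Reduction of the differentiable hypotheses to monotonicity and convexity. -/

section Regularity

theorem FirstThreeInequalities.nonnegAntitoneConvex {f : ℝ → ℝ} (h : FirstThreeInequalities f) :
    NonnegAntitoneConvex f := by
  obtain ⟨h1, h2, h3⟩ := h
  refine ⟨fun t ht => by simpa using h3 0 (by norm_num) t ht, ?_, ?_⟩
  · refine antitoneOn_of_deriv_nonpos (convex_Ioi 0) h1.continuousOn (by simpa using h1) ?_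
    intro t ht
    rw [interior_Ioi] at ht
    simpa using h3 1 (by norm_num) t ht
  · refine convexOn_of_deriv2_nonneg' (convex_Ioi 0) h1 h2 fun t ht => ?_
    simpa [iteratedDeriv_eq_iterate] using h3 2 le_rfl t ht

theorem CompletelyMonotone.firstThreeInequalities {f : ℝ → ℝ} (h : CompletelyMonotone f) :
    FirstThreeInequalities f :=
  ⟨h.1.differentiableOn (by simp),
    (h.1.deriv_of_isOpen (m := 1) isOpen_Ioi (by norm_cast)).differentiableOn (by simp),
    fun n _ => h.2 n⟩

end Regularity

end

end Viscoelastic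

theorem mainTheorem5 {d : ℕ} (ρ : ℝ) (hρ : 0 < ρ) (G : Viscoelastic.TensorFun d) :
    (Viscoelastic.IsLICM G → Viscoelastic.FluxAngleAcute ρ G) ∧
    (Viscoelastic.IsRelaxationModulus G →
      Viscoelastic.InFormSense Viscoelastic.FirstThreeInequalities G →
      Viscoelastic.FluxAngleAcute ρ G) ∧
    (Viscoelastic.IsRelaxationModulus G →
      Viscoelastic.InFormSense Viscoelastic.NonnegAntitoneConvex G →
      Viscoelastic.FluxAngleAcute ρ G) :=
  ⟨fun h => Viscoelastic.fluxAngleAcute_of_nonnegAntitoneConvex ρ h.1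
      fun e he => (h.2 e he).firstThreeInequalities.nonnegAntitoneConvex,
    fun hG h => Viscoelastic.fluxAngleAcute_of_nonnegAntitoneConvex ρ hG
      fun e he => (h e he).nonnegAntitoneConvex,
    fun hG h => Viscoelastic.fluxAngleAcute_of_nonnegAntitoneConvex ρ hG h⟩
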